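/- Consider a trial-offer market with $N$ items (and $N$ positions) and $K$ classes of consumers. Consumers of class $k$ arrive according to a Poisson process of rate $\lambda_k\ge 0$ (not all rates zero), so each arriving consumer is, independently of the past, of class $k$ with probability $w_k=\lambda_k/\sum_l\lambda_l$. Position $j$ has visibility $v_j$, with $v_1\ge v_2\ge\dots\ge v_N\ge 0$; item $i$ has appeal $a_{i,k}>0$ and quality $q_{i,k}\in[0,1]$ for class $k$; and $z\ge 0$ is a constant. A consumer of class $k$ who is shown a ranking $\sigma\in S_N$ (item $i$ is in position $\sigma(i)$) and a popularity vector $d\in\mathbb N^N$ tries item $i$ with probability $$p_{i,k}(\sigma,d)=\frac{v_{\sigma(i)}(a_{i,k}+d_i)}{\sum_{j=1}^N v_{\sigma(j)}(a_{j,k}+d_j)+z},$$ and buys the item she tries with probability $q_{i,k}$. One consumer arrives in each period $t$, and the market starts without any purchases. Let $d_{i,k}^t$ be the number of purchases of item $i$ by consumers of class $k$ before period $t$, let $d_k^t=(d_{i,k}^t)_i$ and $d^t=\sum_k d_k^t$, and let $\bar q_i=\sum_k w_kq_{i,k}$. AQGSI: every consumer is shown a fixed average quality ranking $\sigma$ (one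 that orders the items by decreasing $\bar q_i$) and the global signal $d^t$. SQSSI: a consumer of class $k$ is shown a fixed ranking $\sigma_k$ that orders the items by decreasing $q_{i,k}$, and the signal $d_k^t$ of her own class. Let $P^t_{AQGSI}$ and $P^t_{SQSSI}$ be the (unconditional) probabilities that the consumer of period $t$ makes a purchase under the two policies. Suppose that both rankings are tie-breaking: there is an item $i^*$ with $\bar q_{i^*}v_{\sigma(i^*)}>\bar q_iv_{\sigma(i)}$ for all $i\neq i^*$, and for every class $k$ there is an item $i^*_k$ with $q_{i^*_k,k}>q_{j,k}$ for all $j\ne i^*_k$. Suppose also that $\bar q_iv_{\sigma(i)}>0$ for some $i$ (this is automatic when $N\ge 2$). Then $P^t_{AQGSI}>0$ for all $t$, the limit below exists, and $$1\le\lim_{t\to\infty}\frac{P^t_{SQSSI}}{P^t_{AQGSI}}\le K .$$ -/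

import Mathlib

open MeasureTheory ProbabilityTheory Filter Topology

/-- A trial-offer market with `N` items (equivalently `N` positions) and `K` consumer classes,
in which consumers choose the item they try by a mixed multinomial logit model. -/
structure Market (K N : ℕ) where
  /-- Poisson arrival rate of each consumer class. -/
  rate : Fin K → ℝ
  rate_nonneg : ∀ k, 0 ≤ rate k
  rate_sum_pos : 0 < ∑ k, rate k
  /-- Visibility of each position; positions are listed by decreasing visibility. -/
  visibility : Fin N → ℝ
  visibility_nonneg : ∀ j, 0 ≤ visibility j
  visibility_antitone : Antitone visibility
  /-- `appeal i k` is the intrinsic appeal of item `i` for class `k`. -/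
  appeal : Fin N → Fin K → ℝ
  appeal_pos : ∀ i k, 0 < appeal i k
  /-- `quality i k` is the probability that a consumer of class `k` who tries item `i` buys it. -/
  quality : Fin N → Fin K → ℝ
  quality_nonneg : ∀ i k, 0 ≤ quality i k
  quality_le_one : ∀ i k, quality i k ≤ 1
  /-- The constant `z` of the logit model (weight of trying nothing). -/
  outside : ℝ
  outside_nonneg : 0 ≤ outside

/-- Sales records: `D k i` is the number of purchases of item `i` made so far by class `k`. -/
abbrev Sales (K N : ℕ) : Type := Fin K → Fin N → ℕ

/-- What the firm shows to each class: a static ranking (`ranking k i` is the position of item `i`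
in the list shown to class `k`) and a popularity signal computed from the sales records. -/
structure Display (K N : ℕ) where
  ranking : Fin K → Equiv.Perm (Fin N)
  signal : Sales K N → Fin K → Fin N → ℕ

/-- One ranking `σ` for everybody, with the global popularity signal: total purchases per item. -/
def Display.global {K N : ℕ} (σ : Equiv.Perm (Fin N)) : Display K N where
  ranking := fun _ => σ
  signal := fun D _ i => ∑ k, D k i

/-- One ranking per class, each class being shown the purchases made by its own members only. -/
def Display.segmented {K N : ℕ} (τ : Fin K → Equiv.Perm (Fin N)) : Display K N where
  ranking := τ
  signal := fun D => D

/-- The sales records after a consumer of class `k` has bought item `i`. -/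
def Sales.record {K N : ℕ} (D : Sales K N) (k : Fin K) (i : Fin N) : Sales K N :=
  fun k' i' => D k' i' + if k' = k ∧ i' = i then 1 else 0

namespace Market

variable {K N : ℕ} (M : Market K N)

/-- The weight `w_k` of class `k`: the probability that the next consumer is of class `k`. -/
noncomputable def weight (k : Fin K) : ℝ := M.rate k / ∑ l, M.rate l

/-- The weighted average quality of item `i`. -/
noncomputable def avgQuality (i : Fin N) : ℝ := ∑ k, M.weight k * M.quality i k

/-- Probability that a consumer of class `k`, shown the ranking `σ` and the popularity vector `d`,
tries item `i`. -/
noncomputable def trialProb (σ : Equiv.Perm (Fin N)) (d : Fin N → ℕ) (i : Fin N) (k : Fin K) : ℝ :=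
  M.visibility (σ i) * (M.appeal i k + d i) /
    (∑ j, M.visibility (σ j) * (M.appeal j k + d j) + M.outside)

/-- Probability, given the sales records `D`, that the next consumer is of class `k` and tries and
then buys item `i`. -/
noncomputable def buyProb (π : Display K N) (D : Sales K N) (k : Fin K) (i : Fin N) : ℝ :=
  M.weight k * (M.trialProb (π.ranking k) (π.signal D k) i k * M.quality i k)

/-- Law of the sales records after the next period, given the present records `D`: purchase
`(k, i)` is recorded with probability `buyProb π D k i`; otherwise nothing changes. -/
noncomputable def stepMeasure (π : Display K N) (D : Sales K N) : Measure (Sales K N) :=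
  (∑ k, ∑ i, ENNReal.ofReal (M.buyProb π D k i) • Measure.dirac (D.record k i)) +
    ENNReal.ofReal (1 - ∑ k, ∑ i, M.buyProb π D k i) • Measure.dirac D

lemma weight_nonneg (k : Fin K) : 0 ≤ M.weight k :=
  div_nonneg (M.rate_nonneg k) M.rate_sum_pos.le

lemma sum_weight : ∑ k, M.weight k = 1 := by
  simp only [weight]
  rw [← Finset.sum_div, div_self M.rate_sum_pos.ne']

lemma attraction_nonneg (σ : Equiv.Perm (Fin N)) (d : Fin N → ℕ) (i : Fin N) (k : Fin K) :
    0 ≤ M.visibility (σ i) * (M.appeal i k + d i) :=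
  mul_nonneg (M.visibility_nonneg _) (add_nonneg (M.appeal_pos i k).le (Nat.cast_nonneg _))

lemma trialProb_nonneg (σ : Equiv.Perm (Fin N)) (d : Fin N → ℕ) (i : Fin N) (k : Fin K) :
    0 ≤ M.trialProb σ d i k :=
  div_nonneg (M.attraction_nonneg σ d i k)
    (add_nonneg (Finset.sum_nonneg fun j _ => M.attraction_nonneg σ d j k) M.outside_nonneg)

lemma sum_trialProb_le_one (σ : Equiv.Perm (Fin N)) (d : Fin N → ℕ) (k : Fin K) :
    ∑ i, M.trialProb σ d i k ≤ 1 := by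
  simp only [trialProb]
  rw [← Finset.sum_div]
  exact div_le_one_of_le₀ (le_add_of_nonneg_right M.outside_nonneg)
    (add_nonneg (Finset.sum_nonneg fun j _ => M.attraction_nonneg σ d j k) M.outside_nonneg)

lemma buyProb_nonneg (π : Display K N) (D : Sales K N) (k : Fin K) (i : Fin N) :
    0 ≤ M.buyProb π D k i :=
  mul_nonneg (M.weight_nonneg k) (mul_nonneg (M.trialProb_nonneg _ _ i k) (M.quality_nonneg i k))

lemma sum_buyProb_le_one (π : Display K N) (D : Sales K N) :
    ∑ k, ∑ i, M.buyProb π D k i ≤ 1 := by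
  rw [← M.sum_weight]
  refine Finset.sum_le_sum fun k _ => ?_
  simp only [buyProb]
  rw [← Finset.mul_sum]
  refine mul_le_of_le_one_right (M.weight_nonneg k) ?_
  refine le_trans (Finset.sum_le_sum fun i _ => ?_)
    (M.sum_trialProb_le_one (π.ranking k) (π.signal D k) k)
  exact mul_le_of_le_one_right (M.trialProb_nonneg _ _ i k) (M.quality_le_one i k)

instance (π : Display K N) (D : Sales K N) : IsProbabilityMeasure (M.stepMeasure π D) := by
  constructor
  have h : (∑ k, ∑ i, ENNReal.ofReal (M.buyProb π D k i))
      = ENNReal.ofReal (∑ k, ∑ i, M.buyProb π D k i) := by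
    rw [ENNReal.ofReal_sum_of_nonneg fun k _ => Finset.sum_nonneg fun i _ => M.buyProb_nonneg π D k i]
    exact Finset.sum_congr rfl fun k _ =>
      (ENNReal.ofReal_sum_of_nonneg fun i _ => M.buyProb_nonneg π D k i).symm
  simp only [stepMeasure, Measure.add_apply, Measure.finsetSum_apply, Measure.smul_apply,
    measure_univ, smul_eq_mul, mul_one]
  rw [h, ← ENNReal.ofReal_add
    (Finset.sum_nonneg fun k _ => Finset.sum_nonneg fun i _ => M.buyProb_nonneg π D k i)
    (sub_nonneg.2 (M.sum_buyProb_le_one π D))]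
  simp

/-- The one-period transition kernel of the sales records. -/
noncomputable def stepKernel (π : Display K N) : Kernel (Sales K N) (Sales K N) where
  toFun := M.stepMeasure π
  measurable' := .of_discrete

instance (π : Display K N) : IsMarkovKernel (M.stepKernel π) :=
  ⟨fun D => inferInstanceAs (IsProbabilityMeasure (M.stepMeasure π D))⟩

/-- The same kernel, read on the history of the sales records up to time `n`: only the present
records matter. -/
noncomputable def historyKernel (π : Display K N) (n : ℕ) :
    Kernel (Finset.Iic n → Sales K N) (Sales K N) :=
  (M.stepKernel π).comap (fun h => h ⟨n, Finset.mem_Iic.2 le_rfl⟩) (measurable_pi_apply _)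

instance (π : Display K N) (n : ℕ) : IsMarkovKernel (M.historyKernel π n) := by
  unfold historyKernel
  infer_instance

/-- The law of the market: the distribution of the whole sequence of sales records when the market
starts without any sales (the Markov chain given by the Ionescu-Tulcea theorem). -/
noncomputable def law (π : Display K N) : Measure (ℕ → Sales K N) :=
  Kernel.traj (X := fun _ => Sales K N) (M.historyKernel π) 0 (fun _ => 0)

/-- The probability that the consumer arriving in period `t` makes a purchase, i.e. that the sales
records at the beginning of periods `t` and `t + 1` differ. -/
noncomputable def purchaseProb (π : Display K N) (t : ℕ) : ℝ :=
  (M.law π).real {D | D (t + 1) ≠ D t}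

/-- `σ` is an average quality ranking: it lists the items by decreasing weighted average quality. -/
def IsAverageQualityRanking (σ : Equiv.Perm (Fin N)) : Prop :=
  ∀ i j, σ i < σ j → M.avgQuality j ≤ M.avgQuality i

/-- `τ` is a segmented quality ranking: `τ k` lists the items by decreasing quality for class `k`. -/
def IsSegmentedQualityRanking (τ : Fin K → Equiv.Perm (Fin N)) : Prop :=
  ∀ k i j, τ k i < τ k j → M.quality j k ≤ M.quality i k

/-- The static ranking `σ` is tie-breaking: a unique item has the highest product of visibility and
weighted average quality. -/
def IsTieBreaking (σ : Equiv.Perm (Fin N)) : Prop :=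
  ∃ i, ∀ j, j ≠ i →
    M.avgQuality j * M.visibility (σ j) < M.avgQuality i * M.visibility (σ i)

/-- The segmented quality ranking is tie-breaking: in each class a unique item has the highest
quality. -/
def IsSegmentedTieBreaking : Prop :=
  ∀ k, ∃ i, ∀ j, j ≠ i → M.quality j k < M.quality i k

end Market

/-! Consumers who share a ranking and the signal made of their own purchases drive a generalized
Pólya urn. Item `i` gains a purchase with probability close to `θ i * d i / T`, where `θ i` is its
visibility times its quality for the group and `T` is the total attraction. If `s` alone maximises
`θ`, its count outgrows all the others and the market tends to a monopoly of `s`. The group's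
purchase probability then tends to the group's quality for `s` (`tendsto_meanFrom_groupBuyProb`).

The monopoly is proved in mean. The function `lyapunov` behaves like `(1 + ∑ j ≠ s, d j ^ ε) / d s ^
ε`. The gap `δ` in `θ` makes its expected relative decrease at least of order `1 / T`
(`lyapunov_drift_le`). There is at most one purchase per period, so `T` is at most linear in `t`;
the harmonic series diverges and the mean tends to `0` (`tendsto_zero_of_harmonic_contraction`). The
probability of not trying `s` is bounded by a multiple of this function
(`one_sub_share_le_lyapunov`).

Under the global signal the group is everybody and the limit is the average quality of `s`; under
segmentation each class is a group and the limit is the weighted sum of the best class qualities.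
Every summand is at most the average quality of some item, hence at most that of `s`; this gives the
factor `K`. -/

/-- Total number of purchases in the sales records. -/
def Sales.size {K N : ℕ} (D : Sales K N) : ℕ := ∑ k, ∑ i, D k i

lemma Sales.size_zero {K N : ℕ} : Sales.size (0 : Sales K N) = 0 := by
  simp [Sales.size]

lemma Sales.size_record {K N : ℕ} (D : Sales K N) (k : Fin K) (i : Fin N) :
    (D.record k i).size = D.size + 1 := by
  simp only [Sales.size, Sales.record, Finset.sum_add_distrib]
  congr 1
  rw [Finset.sum_eq_single k, Finset.sum_eq_single i] <;> simp +contextual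

lemma Sales.record_ne {K N : ℕ} (D : Sales K N) (k : Fin K) (i : Fin N) : D.record k i ≠ D := by
  intro h
  have := congrArg Sales.size h
  rw [Sales.size_record] at this
  omega

/-! ### Expectations as finite sums, and their link with the law of the chain. -/

namespace Market

variable {K N : ℕ} (M : Market K N) (π : Display K N)

/-- The probability that the next consumer buys something, given the sales records `D`. -/
noncomputable def totalBuyProb (D : Sales K N) : ℝ := ∑ k, ∑ i, M.buyProb π D k i

/-- The expected value of `f` at the next sales records, given the present records `D`. -/
noncomputable def nextMean (f : Sales K N → ℝ) (D : Sales K N) : ℝ :=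
  ∑ k, ∑ i, M.buyProb π D k i * f (D.record k i) + (1 - M.totalBuyProb π D) * f D

/-- The expected value of `f` after `t` periods, when the market starts at the records `D`. -/
noncomputable def meanFrom : ℕ → (Sales K N → ℝ) → Sales K N → ℝ
  | 0, f => f
  | t + 1, f => M.nextMean π (meanFrom t f)

/-- The definition conditions on the first period; one-step drift estimates and the Markov property
need conditioning on the last. -/
lemma meanFrom_succ' (t : ℕ) (f : Sales K N → ℝ) :
    M.meanFrom π (t + 1) f = M.meanFrom π t (M.nextMean π f) := by
  induction t with
  | zero => rfl
  | succ t ih => rw [meanFrom, ih]; rfl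

lemma totalBuyProb_nonneg (D : Sales K N) : 0 ≤ M.totalBuyProb π D :=
  Finset.sum_nonneg fun _ _ => Finset.sum_nonneg fun _ _ => M.buyProb_nonneg _ _ _ _

lemma totalBuyProb_le_one (D : Sales K N) : M.totalBuyProb π D ≤ 1 := M.sum_buyProb_le_one π D

lemma nextMean_mono {f g : Sales K N → ℝ} {D : Sales K N} (h : f D ≤ g D)
    (h' : ∀ k i, f (D.record k i) ≤ g (D.record k i)) :
    M.nextMean π f D ≤ M.nextMean π g D := by
  refine add_le_add (Finset.sum_le_sum fun k _ => Finset.sum_le_sum fun i _ =>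
    mul_le_mul_of_nonneg_left (h' k i) (M.buyProb_nonneg _ _ _ _)) ?_
  exact mul_le_mul_of_nonneg_left h (sub_nonneg.2 (M.totalBuyProb_le_one π D))

lemma nextMean_eq_add (f : Sales K N → ℝ) (D : Sales K N) :
    M.nextMean π f D = f D + ∑ k, ∑ i, M.buyProb π D k i * (f (D.record k i) - f D) := by
  simp only [nextMean, totalBuyProb, mul_sub, Finset.sum_sub_distrib, ← Finset.sum_mul]
  ring

lemma nextMean_const (c : ℝ) (D : Sales K N) : M.nextMean π (fun _ => c) D = c := by
  simp [nextMean_eq_add]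

lemma nextMean_add (f g : Sales K N → ℝ) :
    M.nextMean π (fun D => f D + g D) = fun D => M.nextMean π f D + M.nextMean π g D := by
  funext D
  simp only [nextMean, mul_add, Finset.sum_add_distrib]
  ring

lemma nextMean_const_mul (c : ℝ) (f : Sales K N → ℝ) :
    M.nextMean π (fun D => c * f D) = fun D => c * M.nextMean π f D := by
  funext D
  simp only [nextMean, mul_add, Finset.mul_sum]
  congr 1
  · exact Finset.sum_congr rfl fun k _ => Finset.sum_congr rfl fun i _ => by ring
  · ring

lemma meanFrom_const (t : ℕ) (c : ℝ) : M.meanFrom π t (fun _ => c) = fun _ => c := by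
  induction t with
  | zero => rfl
  | succ t ih => funext D; rw [meanFrom, ih, nextMean_const]

lemma meanFrom_add (t : ℕ) (f g : Sales K N → ℝ) :
    M.meanFrom π t (fun D => f D + g D) =
      fun D => M.meanFrom π t f D + M.meanFrom π t g D := by
  induction t with
  | zero => rfl
  | succ t ih => rw [meanFrom, ih, nextMean_add]; rfl

lemma meanFrom_const_mul (t : ℕ) (c : ℝ) (f : Sales K N → ℝ) :
    M.meanFrom π t (fun D => c * f D) = fun D => c * M.meanFrom π t f D := by
  induction t with
  | zero => rfl
  | succ t ih => rw [meanFrom, ih, nextMean_const_mul]; rfl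

lemma meanFrom_sum {ι : Type*} (s : Finset ι) (t : ℕ) (f : ι → Sales K N → ℝ) :
    M.meanFrom π t (fun D => ∑ a ∈ s, f a D) = fun D => ∑ a ∈ s, M.meanFrom π t (f a) D := by
  classical
  induction s using Finset.induction_on with
  | empty => simpa using M.meanFrom_const π t 0
  | insert a s ha ih => simp only [Finset.sum_insert ha, meanFrom_add, ih]

/-- After `t` periods at most `t` purchases have been added. -/
lemma meanFrom_mono {t : ℕ} {f g : Sales K N → ℝ} {D : Sales K N}
    (h : ∀ D' : Sales K N, D'.size ≤ D.size + t → f D' ≤ g D') :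
    M.meanFrom π t f D ≤ M.meanFrom π t g D := by
  induction t generalizing D with
  | zero => exact h D le_rfl
  | succ t ih =>
    refine M.nextMean_mono π (ih fun D' h' => h D' (by omega)) fun k i => ih fun D' h' => h D' ?_
    rw [Sales.size_record] at h'
    omega

lemma meanFrom_nonneg (t : ℕ) {f : Sales K N → ℝ} (hf : ∀ D, 0 ≤ f D) (D : Sales K N) :
    0 ≤ M.meanFrom π t f D := by
  have := M.meanFrom_mono π (t := t) (D := D) (f := fun _ => 0) (g := f) fun D' _ => hf D'
  rwa [meanFrom_const] at this

lemma meanFrom_pos (t : ℕ) {f : Sales K N → ℝ} (hf : ∀ D, 0 < f D) (D : Sales K N) :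
    0 < M.meanFrom π t f D := by
  induction t generalizing D with
  | zero => exact hf D
  | succ t ih =>
    rw [meanFrom, nextMean]
    -- The transition probabilities out of `D` sum to one, so one of them is positive: either
    -- staying at `D`, or some purchase.
    rcases (M.totalBuyProb_le_one π D).lt_or_eq with h | h
    · exact add_pos_of_nonneg_of_pos (Finset.sum_nonneg fun k _ => Finset.sum_nonneg fun i _ =>
        mul_nonneg (M.buyProb_nonneg _ _ _ _) (ih _).le) (mul_pos (sub_pos.2 h) (ih D))
    · refine add_pos_of_pos_of_nonneg ?_ (mul_nonneg (sub_nonneg.2 h.le) (ih D).le)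
      have h1 : 0 < M.totalBuyProb π D := by rw [h]; exact one_pos
      obtain ⟨k, hk, hk'⟩ := Finset.exists_lt_of_sum_lt
        (s := Finset.univ) (f := fun _ : Fin K => (0 : ℝ)) (by simpa [totalBuyProb] using h1)
      obtain ⟨i, hi, hi'⟩ := Finset.exists_lt_of_sum_lt
        (s := Finset.univ) (f := fun _ : Fin N => (0 : ℝ)) (by simpa using hk')
      have hn : ∀ k i, 0 ≤ M.buyProb π D k i * M.meanFrom π t f (D.record k i) := fun k i =>
        mul_nonneg (M.buyProb_nonneg _ _ _ _) (ih _).le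
      exact Finset.sum_pos' (fun k _ => Finset.sum_nonneg fun i _ => hn k i)
        ⟨k, hk, Finset.sum_pos' (fun i _ => hn k i) ⟨i, hi, mul_pos hi' (ih _)⟩⟩

lemma abs_meanFrom_sub_le (t : ℕ) {f g : Sales K N → ℝ} {c : ℝ} (h : ∀ D, |f D - c| ≤ g D)
    (D : Sales K N) : |M.meanFrom π t f D - c| ≤ M.meanFrom π t g D := by
  have h1 := M.meanFrom_mono π (t := t) (D := D) (f := f) (g := fun D => c + g D)
    fun D' _ => by linarith [(abs_le.1 (h D')).2]
  have h2 := M.meanFrom_mono π (t := t) (D := D) (f := fun _ => c) (g := fun D => f D + g D)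
    fun D' _ => by linarith [(abs_le.1 (h D')).1]
  simp only [meanFrom_add, meanFrom_const] at h1 h2
  exact abs_le.2 ⟨by linarith, by linarith⟩

lemma lintegral_stepMeasure (D : Sales K N) {f : Sales K N → ℝ} (hf : ∀ D, 0 ≤ f D) :
    ∫⁻ D', ENNReal.ofReal (f D') ∂M.stepMeasure π D = ENNReal.ofReal (M.nextMean π f D) := by
  have hb : ∀ k i, 0 ≤ M.buyProb π D k i * f (D.record k i) := fun k i =>
    mul_nonneg (M.buyProb_nonneg _ _ _ _) (hf _)
  have h1 := sub_nonneg.2 (M.totalBuyProb_le_one π D)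
  rw [nextMean, ENNReal.ofReal_add (Finset.sum_nonneg fun k _ => Finset.sum_nonneg fun i _ => hb k i)
    (mul_nonneg h1 (hf D)), ENNReal.ofReal_mul h1,
    ENNReal.ofReal_sum_of_nonneg fun k _ => Finset.sum_nonneg fun i _ => hb k i]
  simp only [stepMeasure, lintegral_add_measure, lintegral_finsetSum_measure,
    lintegral_smul_measure, lintegral_dirac, smul_eq_mul, totalBuyProb]
  congr 1
  refine Finset.sum_congr rfl fun k _ => ?_
  rw [ENNReal.ofReal_sum_of_nonneg fun i _ => hb k i]
  exact Finset.sum_congr rfl fun i _ => (ENNReal.ofReal_mul (M.buyProb_nonneg _ _ _ _)).symm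

lemma stepMeasure_ne (D : Sales K N) :
    M.stepMeasure π D {D' | D' ≠ D} = ENNReal.ofReal (M.totalBuyProb π D) := by
  classical
  have h := M.lintegral_stepMeasure π D (f := {D' | D' ≠ D}.indicator 1)
    (Set.indicator_nonneg fun _ _ => zero_le_one)
  have h2 : (fun D' => ENNReal.ofReal ({D' | D' ≠ D}.indicator (1 : Sales K N → ℝ) D')) =
      {D' | D' ≠ D}.indicator 1 := by
    funext D'
    by_cases hD : D' = D <;> simp [hD]
  rw [h2, lintegral_indicator_one (MeasurableSet.of_discrete)] at h
  rw [h, nextMean, totalBuyProb]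
  simp [Sales.record_ne]

/-- The Markov property: in the Ionescu-Tulcea construction the history up to `t + 1` is the history
up to `t` composed with `historyKernel`, which sees only the present records. -/
lemma lintegral_law_pair (t : ℕ) (F : Sales K N → Sales K N → ENNReal) :
    ∫⁻ D, F (D t) (D (t + 1)) ∂M.law π =
      ∫⁻ D, ∫⁻ D', F (D t) D' ∂M.stepMeasure π (D t) ∂M.law π := by
  have hF : Measurable (Function.uncurry F) := .of_discrete
  have key := Kernel.partialTraj_compProd_eq_map_traj (X := fun _ => Sales K N)
    (κ := M.historyKernel π) (Nat.zero_le t) (x₀ := fun _ => 0)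
  let G : (Finset.Iic t → Sales K N) × Sales K N → ENNReal :=
    fun p => F (p.1 ⟨t, Finset.mem_Iic.2 le_rfl⟩) p.2
  have hp : Measurable fun p : (Finset.Iic t → Sales K N) × Sales K N =>
      (p.1 ⟨t, Finset.mem_Iic.2 le_rfl⟩, p.2) :=
    ((measurable_pi_apply _).comp measurable_fst).prodMk measurable_snd
  have hG : Measurable G := hF.comp hp
  have e := congrArg (fun μ => ∫⁻ p, G p ∂μ) key
  beta_reduce at e
  rw [lintegral_map hG (by fun_prop), Measure.lintegral_compProd hG,
    ← Kernel.traj_map_frestrictLe_apply, lintegral_map ?_ (by fun_prop)] at e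
  · exact e.symm
  · exact hG.lintegral_kernel_prod_right'

lemma lintegral_law (t : ℕ) {f : Sales K N → ℝ} (hf : ∀ D, 0 ≤ f D) :
    ∫⁻ D, ENNReal.ofReal (f (D t)) ∂M.law π = ENNReal.ofReal (M.meanFrom π t f 0) := by
  induction t generalizing f with
  | zero =>
    have key := Kernel.traj_map_frestrictLe_apply (X := fun _ => Sales K N)
      (κ := M.historyKernel π) 0 0 (fun _ => 0)
    have e := congrArg (fun μ => ∫⁻ p : Finset.Iic 0 → Sales K N,
      ENNReal.ofReal (f (p ⟨0, Finset.mem_Iic.2 le_rfl⟩)) ∂μ) key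
    have hm : Measurable fun p : Finset.Iic 0 → Sales K N =>
        ENNReal.ofReal (f (p ⟨0, Finset.mem_Iic.2 le_rfl⟩)) :=
      (Measurable.of_discrete (f := fun D => ENNReal.ofReal (f D))).comp (measurable_pi_apply _)
    beta_reduce at e
    rw [lintegral_map hm (by fun_prop), Kernel.partialTraj_self, Kernel.id_apply,
      lintegral_dirac' _ hm] at e
    exact e
  | succ t ih =>
    rw [M.lintegral_law_pair π t fun _ D' => ENNReal.ofReal (f D'), meanFrom_succ', ← ih]
    · simp only [M.lintegral_stepMeasure π _ hf]
    · intro D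
      have := M.nextMean_mono π (f := fun _ => 0) (g := f) (D := D) (hf D) fun k i => hf _
      rwa [nextMean_const] at this

/-- Recording a purchase always changes the records, so a change in period `t` has conditional
probability `totalBuyProb`. All later work takes place in finite sums. -/
lemma purchaseProb_eq_meanFrom (t : ℕ) :
    M.purchaseProb π t = M.meanFrom π t (M.totalBuyProb π) 0 := by
  classical
  have h := M.lintegral_law_pair π t fun D D' => {D' | D' ≠ D}.indicator 1 D'
  have h1 : ∀ D : Sales K N, ∫⁻ D', {D' | D' ≠ D}.indicator 1 D' ∂M.stepMeasure π D =
      ENNReal.ofReal (M.totalBuyProb π D) := fun D => by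
    rw [lintegral_indicator_one (MeasurableSet.of_discrete), stepMeasure_ne]
  simp only [h1, M.lintegral_law π t (M.totalBuyProb_nonneg π)] at h
  have h2 : (fun D : ℕ → Sales K N => {D' | D' ≠ D t}.indicator (1 : Sales K N → ENNReal) (D (t + 1)))
      = {D | D (t + 1) ≠ D t}.indicator 1 := rfl
  have hs : MeasurableSet {D : ℕ → Sales K N | D (t + 1) ≠ D t} :=
    (measurableSet_eq_fun (measurable_pi_apply (t + 1)) (measurable_pi_apply t)).compl
  rw [h2, lintegral_indicator_one hs] at h
  rw [purchaseProb, Measure.real, h,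
    ENNReal.toReal_ofReal (M.meanFrom_nonneg π t (M.totalBuyProb_nonneg π) 0)]

end Market

/-! ### Real-variable estimates. -/

lemma add_one_rpow_le {x ε : ℝ} (hx : 0 < x) (h0 : 0 ≤ ε) (h1 : ε ≤ 1) :
    (x + 1) ^ ε ≤ x ^ ε * (1 + ε / x) := by
  have h := rpow_one_add_le_one_add_mul_self (s := 1 / x) (by linarith [one_div_pos.2 hx]) h0 h1
  have e : x + 1 = x * (1 + 1 / x) := by field_simp
  rw [e, Real.mul_rpow hx.le (by positivity)]
  refine mul_le_mul_of_nonneg_left (h.trans_eq ?_) (by positivity)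
  ring

/-- A decreasing function comparable to `x ^ (-ε)` at infinity, whose relative decrements exceed
those of `x ^ (-ε)` by a term of order `x⁻²`. -/
noncomputable def decayPotential (ε κ x : ℝ) : ℝ := x ^ (-ε) * Real.exp (κ / x)

lemma decayPotential_pos {ε κ x : ℝ} (hx : 0 < x) : 0 < decayPotential ε κ x := by
  unfold decayPotential; positivity

lemma rpow_neg_le_decayPotential {ε κ x : ℝ} (hx : 0 < x) (hκ : 0 ≤ κ) :
    x ^ (-ε) ≤ decayPotential ε κ x := by
  refine le_mul_of_one_le_right (by positivity) (Real.one_le_exp (by positivity))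

/-- The power `x ^ (-ε)` alone falls short of the required decrement by `O(x⁻²)`; the factor `exp (κ
/ x)` adds `κ / (x * (x + 1))` to the logarithmic decrement and makes up for it. -/
lemma exists_decayPotential_add_one_le {B C : ℝ} (hB : 0 < B) (hC : 0 ≤ C) :
    ∃ ε κ : ℝ, 0 < ε ∧ ε ≤ 1 ∧ 0 ≤ κ ∧ ∀ x, B ≤ x →
      decayPotential ε κ (x + 1) ≤ decayPotential ε κ x * (1 - ε / x * (1 + C / x)) := by
  set Q : ℝ := 1 + C / B with hQ
  have hQ1 : 1 ≤ Q := by rw [hQ]; linarith [div_nonneg hC hB.le]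
  -- This forces `y ≤ 1 / 2` below, where `(1 - y) * (1 + y + 2 * y ^ 2) ≥ 1`.
  set ε : ℝ := min 1 (B / (2 * Q)) with hε
  have hε0 : 0 < ε := by rw [hε]; positivity
  have hε1 : ε ≤ 1 := min_le_left _ _
  have hεB : ε * (2 * Q) ≤ B := by
    have : ε ≤ B / (2 * Q) := min_le_right _ _
    rwa [le_div_iff₀ (by positivity)] at this
  -- The `1` turns `ε / (x + 1)` into `ε / x`; the factor `(B + 1) / B` bounds `(x + 1) / x`, so
  -- that the rest covers both `C` and `2 * y ^ 2`.
  set κ : ℝ := ε * (1 + (B + 1) / B * (C + 2 * Q ^ 2)) with hκ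
  have hκ0 : 0 ≤ κ := by positivity
  refine ⟨ε, κ, hε0, hε1, hκ0, fun x hx => ?_⟩
  have hx0 : 0 < x := hB.trans_le hx
  set y : ℝ := ε / x * (1 + C / x) with hy
  set s : ℝ := ε / (x + 1) + κ / (x * (x + 1)) with hs
  have hy0 : 0 ≤ y := by positivity
  have hQx : 1 + C / x ≤ Q := by
    have : C / x ≤ C / B := div_le_div_of_nonneg_left hC hB hx
    linarith
  have hyQ : y ≤ ε / x * Q := mul_le_mul_of_nonneg_left hQx (by positivity)
  have hy2 : y ≤ 1 / 2 := by
    refine hyQ.trans ?_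
    rw [div_mul_eq_mul_div, div_le_iff₀ hx0]
    linarith
  have hysq : y ^ 2 ≤ ε / x ^ 2 * Q ^ 2 := by
    calc y ^ 2 ≤ (ε / x * Q) ^ 2 := pow_le_pow_left₀ hy0 hyQ 2
      _ = ε * (ε / x ^ 2 * Q ^ 2) := by ring
      _ ≤ 1 * (ε / x ^ 2 * Q ^ 2) := mul_le_mul_of_nonneg_right hε1 (by positivity)
      _ = _ := one_mul _
  have hsy : y + 2 * y ^ 2 ≤ s := by
    have e1 : y = ε / x + ε / x ^ 2 * C := by rw [hy]; field_simp
    have e2 : s = ε / x + ε * (C + 2 * Q ^ 2) * ((B + 1) / B / (x * (x + 1))) := by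
      rw [hs, hκ]; field_simp; ring
    have e3 : 1 / x ^ 2 ≤ (B + 1) / B / (x * (x + 1)) := by
      rw [div_div, div_le_div_iff₀ (by positivity) (by positivity)]
      nlinarith
    have e4 := mul_le_mul_of_nonneg_left e3 (show 0 ≤ ε * (C + 2 * Q ^ 2) by positivity)
    have e5 : ε * (C + 2 * Q ^ 2) * (1 / x ^ 2) = ε / x ^ 2 * C + 2 * (ε / x ^ 2 * Q ^ 2) := by
      ring
    rw [e2]
    linarith
  have hs0 : 0 ≤ s := by positivity
  have hexp : Real.exp (-s) ≤ 1 - y := by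
    rw [Real.exp_neg]
    refine (inv_anti₀ (by positivity) (Real.add_one_le_exp s)).trans ?_
    rw [inv_le_iff_one_le_mul₀ (by positivity)]
    nlinarith
  have hlog : decayPotential ε κ (x + 1) ≤ decayPotential ε κ x * Real.exp (-s) := by
    have hlog1 : 1 / (x + 1) ≤ Real.log (x + 1) - Real.log x := by
      have := Real.one_sub_inv_le_log_of_pos (show 0 < (x + 1) / x by positivity)
      rw [Real.log_div (by positivity) hx0.ne'] at this
      convert this using 1
      field_simp
      ring
    have h2 := mul_le_mul_of_nonneg_left hlog1 hε0.le
    unfold decayPotential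
    rw [Real.rpow_def_of_pos (by positivity), Real.rpow_def_of_pos hx0, ← Real.exp_add,
      ← Real.exp_add, ← Real.exp_add, Real.exp_le_exp]
    have e6 : κ / (x * (x + 1)) = κ / x - κ / (x + 1) := by field_simp; ring
    have e7 : ε / (x + 1) = ε * (1 / (x + 1)) := by ring
    rw [hs, e6, e7]
    linarith
  exact hlog.trans (mul_le_mul_of_nonneg_left hexp (decayPotential_pos hx0).le)

/-- Iterating `1 - u ≤ exp (-u)` bounds `e t` by the exponential of minus a multiple of the harmonic
sum. -/
lemma tendsto_zero_of_harmonic_contraction {e : ℕ → ℝ} {c a b : ℝ} (hc : 0 < c) (ha : 0 < a)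
    (hb : 0 ≤ b) (he : ∀ t, 0 ≤ e t) (h : ∀ t : ℕ, e (t + 1) ≤ (1 - c / (a + b * t)) * e t) :
    Tendsto e atTop (𝓝 0) := by
  have h1 : ∀ t : ℕ, e t ≤ e 0 * Real.exp (-(c / (a + b) * ∑ s ∈ Finset.range t, 1 / ((s : ℝ) + 1))) := by
    intro t
    induction t with
    | zero => simp
    | succ t ih =>
      rw [Finset.sum_range_succ, mul_add, neg_add, Real.exp_add, ← mul_assoc, mul_comm (e 0 * _)]
      refine (h t).trans (mul_le_mul ?_ ih (he t) (Real.exp_pos _).le)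
      refine le_trans ?_ (Real.one_sub_le_exp_neg _)
      have : c / (a + b) * (1 / ((t : ℝ) + 1)) ≤ c / (a + b * t) := by
        rw [← mul_div_mul_comm, mul_one]
        refine div_le_div_of_nonneg_left hc.le (by positivity) ?_
        have : (0 : ℝ) ≤ t := t.cast_nonneg
        nlinarith
      linarith
  have h2 : Tendsto (fun t : ℕ => e 0 * Real.exp (-(c / (a + b) *
      ∑ s ∈ Finset.range t, 1 / ((s : ℝ) + 1)))) atTop (𝓝 (e 0 * 0)) := by
    refine Tendsto.const_mul _ (Real.tendsto_exp_atBot.comp (tendsto_neg_atTop_atBot.comp ?_))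
    exact Real.tendsto_sum_range_one_div_nat_succ_atTop.const_mul_atTop (by positivity)
  rw [mul_zero] at h2
  exact squeeze_zero he h1 h2

/-! ### The Lyapunov function: drift, and control of the market shares. -/

/-- A Lyapunov function for popularity vectors, small when item `s` dominates the others. -/
noncomputable def lyapunov {N : ℕ} (s : Fin N) (A B ε κ : ℝ) (d : Fin N → ℕ) : ℝ :=
  (1 + ∑ j ∈ Finset.univ.erase s, ((d j : ℝ) + A) ^ ε) * decayPotential ε κ (d s + B)

lemma lyapunov_nonneg {N : ℕ} (s : Fin N) {A B : ℝ} (ε κ : ℝ) (hA : 0 ≤ A) (hB : 0 < B)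
    (d : Fin N → ℕ) : 0 ≤ lyapunov s A B ε κ d := by
  refine mul_nonneg (add_nonneg zero_le_one (Finset.sum_nonneg fun j _ => ?_))
    (decayPotential_pos (by positivity)).le
  positivity

/-- Expected decrease of the Lyapunov function when item `i` gets a purchase with
probability `r i`. -/
lemma lyapunov_drift_le {N : ℕ} {s : Fin N} {A B ε κ δ U Y : ℝ} {d : Fin N → ℕ}
    {r θ : Fin N → ℝ} (hA : 0 < A) (hB : 0 < B) (hε0 : 0 < ε) (hε1 : ε ≤ 1) (hδ : 0 < δ)
    (hU : 0 < U) (hY : 1 ≤ Y) (hr : ∀ i, 0 ≤ r i) (hδs : δ ≤ θ s)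
    (hδj : ∀ j, j ≠ s → θ j + δ ≤ θ s)
    (hrj : ∀ j, j ≠ s → r j ≤ (d j + A) * (θ j * (Y / U)))
    (hrs : (d s + B) * (θ s / U) ≤ r s)
    (hpot : decayPotential ε κ (d s + B + 1) ≤
      decayPotential ε κ (d s + B) * (1 - ε / (d s + B) * Y)) :
    ∑ i, r i * (lyapunov s A B ε κ (Function.update d i (d i + 1)) - lyapunov s A B ε κ d) ≤
      -(ε * δ / U) * lyapunov s A B ε κ d := by
  set x : ℝ := d s + B with hx
  have hx0 : 0 < x := by positivity
  set g := decayPotential ε κ x with hg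
  have hg0 : 0 < g := decayPotential_pos hx0
  set h : Fin N → ℝ := fun j => ((d j : ℝ) + A) ^ ε with hh
  have hh0 : ∀ j, 0 < h j := fun j => by simp only [hh]; positivity
  have hF : lyapunov s A B ε κ d = (1 + ∑ j ∈ Finset.univ.erase s, h j) * g := rfl
  set H : ℝ := 1 + ∑ j ∈ Finset.univ.erase s, h j with hH
  have hH0 : 0 < H := add_pos_of_pos_of_nonneg one_pos (Finset.sum_nonneg fun j _ => (hh0 j).le)
  -- The bound on `r s` lacks the factor `Y` present in the bounds on the other `r j`; the extra
  -- decay in `hpot` supplies it, so gains and losses share the factor `ε * Y / U * g`.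
  have hs : r s * (lyapunov s A B ε κ (Function.update d s (d s + 1)) - lyapunov s A B ε κ d) ≤
      -(θ s * (ε * Y / U * g)) * H := by
    have e1 : lyapunov s A B ε κ (Function.update d s (d s + 1)) =
        H * decayPotential ε κ (x + 1) := by
      unfold lyapunov
      congr 1
      · rw [hH]
        congr 1
        refine Finset.sum_congr rfl fun j hj => ?_
        rw [Function.update_of_ne (Finset.ne_of_mem_erase hj)]
      · rw [Function.update_self, hx]
        push_cast
        congr 1
        ring
    rw [e1, hF]
    have e2 : H * decayPotential ε κ (x + 1) - H * g ≤ -(H * (g * (ε / x * Y))) := by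
      have := mul_le_mul_of_nonneg_left hpot hH0.le
      linarith
    have e3 : 0 ≤ H * (g * (ε / x * Y)) := by positivity
    calc r s * (H * decayPotential ε κ (x + 1) - H * g)
        ≤ r s * -(H * (g * (ε / x * Y))) := mul_le_mul_of_nonneg_left e2 (hr s)
      _ = -(r s * (H * (g * (ε / x * Y)))) := by ring
      _ ≤ -(x * (θ s / U) * (H * (g * (ε / x * Y)))) :=
        neg_le_neg (mul_le_mul_of_nonneg_right hrs e3)
      _ = _ := by field_simp
  have hj : ∀ j ∈ Finset.univ.erase s,
      r j * (lyapunov s A B ε κ (Function.update d j (d j + 1)) - lyapunov s A B ε κ d) ≤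
        θ j * (ε * Y / U * g) * h j := by
    intro j hj
    have hjs : j ≠ s := Finset.ne_of_mem_erase hj
    have hp : (0 : ℝ) < d j + A := by positivity
    have e1 : lyapunov s A B ε κ (Function.update d j (d j + 1)) - lyapunov s A B ε κ d =
        (((d j : ℝ) + A + 1) ^ ε - h j) * g := by
      rw [hF, hH]
      unfold lyapunov
      rw [Function.update_of_ne hjs.symm, ← Finset.add_sum_erase _ _ hj,
        ← Finset.add_sum_erase _ h hj, Function.update_self]
      have e : ∑ i ∈ (Finset.univ.erase s).erase j, ((Function.update d j (d j + 1) i : ℕ) + A) ^ ε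
          = ∑ i ∈ (Finset.univ.erase s).erase j, h i :=
        Finset.sum_congr rfl fun i hi => by
          rw [Function.update_of_ne (Finset.ne_of_mem_erase hi)]
      rw [e]
      have e' : ((d j + 1 : ℕ) : ℝ) + A = d j + A + 1 := by push_cast; ring
      rw [e']
      ring
    have e2 : (((d j : ℝ) + A + 1) ^ ε - h j) * g ≤ h j * (ε / (d j + A)) * g := by
      refine mul_le_mul_of_nonneg_right ?_ hg0.le
      have := add_one_rpow_le hp hε0.le hε1
      simp only [hh]
      linarith
    have e3 : 0 ≤ h j * (ε / (d j + A)) * g :=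
      mul_nonneg (mul_nonneg (hh0 j).le (by positivity)) hg0.le
    rw [e1]
    calc r j * ((((d j : ℝ) + A + 1) ^ ε - h j) * g)
        ≤ r j * (h j * (ε / (d j + A)) * g) := mul_le_mul_of_nonneg_left e2 (hr j)
      _ ≤ (d j + A) * (θ j * (Y / U)) * (h j * (ε / (d j + A)) * g) :=
        mul_le_mul_of_nonneg_right (hrj j hjs) e3
      _ = _ := by field_simp
  rw [← Finset.add_sum_erase _ _ (Finset.mem_univ s), hF]
  have hsum := Finset.sum_le_sum hj
  have hP : 0 ≤ ε * Y / U * g := by positivity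
  have hθ : ∑ j ∈ Finset.univ.erase s, θ j * (ε * Y / U * g) * h j ≤
      (θ s - δ) * (ε * Y / U * g) * (H - 1) := by
    rw [hH, add_sub_cancel_left, Finset.mul_sum]
    refine Finset.sum_le_sum fun j hj => mul_le_mul_of_nonneg_right
      (mul_le_mul_of_nonneg_right ?_ hP) (hh0 j).le
    linarith [hδj j (Finset.ne_of_mem_erase hj)]
  -- The leftover `-(θ s - δ) * (ε * Y / U * g)` comes from the constant `1` in `H`; it is
  -- nonpositive because `δ ≤ θ s`.
  have hfin : (θ s - δ) * (ε * Y / U * g) * (H - 1) - θ s * (ε * Y / U * g) * H ≤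
      -(ε * Y / U * g) * δ * H := by
    nlinarith [mul_nonneg hP (sub_nonneg.2 hδs)]
  have hYU : ε * δ / U * (H * g) ≤ ε * Y / U * g * δ * H := by
    calc ε * δ / U * (H * g) = ε * δ / U * (H * g) * 1 := (mul_one _).symm
      _ ≤ ε * δ / U * (H * g) * Y := mul_le_mul_of_nonneg_left hY (by positivity)
      _ = _ := by ring
  rw [hF] at hs
  simp only [hF] at hsum
  linarith

/-- A number in `[0, 1]` is at most its power `ε ≤ 1`, which turns a ratio bound into one in the
scale of `lyapunov`; `1 ≤ W` absorbs `W ^ ε`. -/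
lemma le_mul_rpow_of_le_one {u W p x ε : ℝ} (hu0 : 0 ≤ u) (hu1 : u ≤ 1) (hW : 1 ≤ W)
    (hp : 0 ≤ p) (hx : 0 < x) (hε0 : 0 ≤ ε) (hε1 : ε ≤ 1) (h : u ≤ W * p / x) :
    u ≤ W * (p ^ ε * x ^ (-ε)) := by
  have hW0 : 0 ≤ W := zero_le_one.trans hW
  calc u = u ^ (1 : ℝ) := (Real.rpow_one u).symm
    _ ≤ u ^ ε := Real.rpow_le_rpow_of_exponent_ge' hu0 hu1 hε0 hε1
    _ ≤ (W * p / x) ^ ε := Real.rpow_le_rpow hu0 h hε0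
    _ = W ^ ε * (p ^ ε * x ^ (-ε)) := by
      rw [Real.div_rpow (by positivity) hx.le, Real.mul_rpow hW0 hp, Real.rpow_neg hx.le]
      ring
    _ ≤ W * (p ^ ε * x ^ (-ε)) := by
      refine mul_le_mul_of_nonneg_right ?_ (by positivity)
      simpa using Real.rpow_le_rpow_of_exponent_le hW hε1

/-- The logit probability of not choosing `s` is controlled by the Lyapunov function. -/
lemma one_sub_share_le_lyapunov {N : ℕ} {s : Fin N} {A B ε κ z : ℝ} {v a : Fin N → ℝ}
    (d : Fin N → ℕ) (hv : ∀ j, 0 ≤ v j) (hvs : 0 < v s) (hB : 0 < B) (haB : ∀ j, B ≤ a j)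
    (haA : ∀ j, a j ≤ A) (hz : 0 ≤ z) (hε0 : 0 ≤ ε) (hε1 : ε ≤ 1) (hκ : 0 ≤ κ) :
    1 - v s * (a s + d s) / (∑ j, v j * (a j + d j) + z) ≤
      (1 + (∑ j, v j + z) / v s) * lyapunov s A B ε κ d := by
  set W := 1 + (∑ j, v j + z) / v s with hW
  have hV : 0 ≤ ∑ j, v j := Finset.sum_nonneg fun j _ => hv j
  have hW1 : 1 ≤ W := le_add_of_nonneg_right (by positivity)
  have ha0 : ∀ j, 0 ≤ a j := fun j => hB.le.trans (haB j)
  have hterm : ∀ j, 0 ≤ v j * (a j + d j) := fun j =>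
    mul_nonneg (hv j) (add_nonneg (ha0 j) (Nat.cast_nonneg _))
  set T := ∑ j, v j * (a j + d j) + z with hT
  set x : ℝ := d s + B with hx
  have hx0 : 0 < x := by positivity
  have hle : ∀ j, v j * (a j + d j) ≤ T := fun j =>
    (Finset.single_le_sum (fun j _ => hterm j) (Finset.mem_univ j)).trans
      (le_add_of_nonneg_right hz)
  have hTx : v s * x ≤ T :=
    (mul_le_mul_of_nonneg_left (by rw [hx]; linarith [haB s]) hvs.le).trans (hle s)
  have hT0 : 0 < T := (mul_pos hvs hx0).trans_le hTx
  have hzT : z ≤ T := le_add_of_nonneg_left (Finset.sum_nonneg fun j _ => hterm j)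
  have hWv : ∀ y, y ≤ ∑ j, v j + z → y ≤ W * v s := fun y hy => by
    rw [hW, add_mul, div_mul_cancel₀ _ hvs.ne', one_mul]
    linarith
  have hdiv : ∀ y p, 0 ≤ y → 0 ≤ p → y ≤ ∑ j, v j + z → y * p / T ≤ W * p / x := by
    intro y p hy hp hyV
    rw [div_le_div_iff₀ hT0 hx0]
    calc y * p * x ≤ W * v s * p * x := by gcongr; exact hWv y hyV
      _ = W * p * (v s * x) := by ring
      _ ≤ W * p * T := by gcongr
  -- The outside option is what the constant `1` in `lyapunov` accounts for.
  have h1 : z / T ≤ W * (1 * x ^ (-ε)) := by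
    have := le_mul_rpow_of_le_one (p := 1) (by positivity) ((div_le_one hT0).2 hzT) hW1
      zero_le_one hx0 hε0 hε1
      (by simpa using hdiv z 1 hz zero_le_one (le_add_of_nonneg_left hV))
    rwa [Real.one_rpow] at this
  have h2 : ∀ j, v j * (a j + d j) / T ≤ W * (((d j : ℝ) + A) ^ ε * x ^ (-ε)) := by
    intro j
    have hAj : 0 ≤ A := (ha0 j).trans (haA j)
    refine le_mul_rpow_of_le_one (div_nonneg (hterm j) hT0.le) ((div_le_one hT0).2 (hle j)) hW1
      (by positivity) hx0 hε0 hε1 (le_trans ?_ (hdiv (v j) (d j + A) (hv j) (by positivity)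
        ((Finset.single_le_sum (fun j _ => hv j) (Finset.mem_univ j)).trans
          (le_add_of_nonneg_right hz))))
    refine div_le_div_of_nonneg_right (mul_le_mul_of_nonneg_left ?_ (hv j)) hT0.le
    linarith [haA j]
  have h3 : 1 - v s * (a s + d s) / T =
      ∑ j ∈ Finset.univ.erase s, v j * (a j + d j) / T + z / T := by
    have e : T = v s * (a s + d s) + ∑ j ∈ Finset.univ.erase s, v j * (a j + d j) + z := by
      rw [Finset.add_sum_erase _ (fun j => v j * (a j + (d j : ℝ))) (Finset.mem_univ s)]
    rw [← Finset.sum_div, ← add_div, eq_div_iff hT0.ne', sub_mul, div_mul_cancel₀ _ hT0.ne']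
    linarith
  have hA0 : 0 ≤ A := (ha0 s).trans (haA s)
  have h4 : (1 + ∑ j ∈ Finset.univ.erase s, ((d j : ℝ) + A) ^ ε) * x ^ (-ε) ≤
      lyapunov s A B ε κ d :=
    mul_le_mul_of_nonneg_left (rpow_neg_le_decayPotential hx0 hκ)
      (add_nonneg zero_le_one (Finset.sum_nonneg fun j _ => by positivity))
  rw [h3]
  calc ∑ j ∈ Finset.univ.erase s, v j * (a j + d j) / T + z / T
      ≤ ∑ j ∈ Finset.univ.erase s, W * (((d j : ℝ) + A) ^ ε * x ^ (-ε)) + W * (1 * x ^ (-ε)) :=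
        add_le_add (Finset.sum_le_sum fun j _ => h2 j) h1
    _ = W * ((1 + ∑ j ∈ Finset.univ.erase s, ((d j : ℝ) + A) ^ ε) * x ^ (-ε)) := by
        rw [← Finset.mul_sum, ← Finset.sum_mul]
        ring
    _ ≤ _ := mul_le_mul_of_nonneg_left h4 (zero_le_one.trans hW1)

/-! ### Groups with a common signal: convergence to monopoly. -/

/-- Purchases of each item made by the members of the classes in `C`. -/
def Sales.groupSales {K N : ℕ} (C : Finset (Fin K)) (D : Sales K N) (i : Fin N) : ℕ :=
  ∑ k ∈ C, D k i

lemma Sales.groupSales_le_size {K N : ℕ} (C : Finset (Fin K)) (D : Sales K N) :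
    ∑ i, D.groupSales C i ≤ D.size := by
  simp only [Sales.groupSales, Sales.size]
  rw [Finset.sum_comm]
  exact Finset.sum_le_sum_of_subset (Finset.subset_univ C)

lemma Sales.groupSales_record_of_notMem {K N : ℕ} {C : Finset (Fin K)} (D : Sales K N) {k : Fin K}
    (hk : k ∉ C) (i : Fin N) : (D.record k i).groupSales C = D.groupSales C := by
  funext j
  refine Finset.sum_congr rfl fun l hl => ?_
  have : l ≠ k := fun h => hk (h ▸ hl)
  simp [Sales.record, this]

lemma Sales.groupSales_record_of_mem {K N : ℕ} {C : Finset (Fin K)} (D : Sales K N) {k : Fin K}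
    (hk : k ∈ C) (i : Fin N) :
    (D.record k i).groupSales C =
      Function.update (D.groupSales C) i (D.groupSales C i + 1) := by
  funext j
  by_cases hj : j = i
  · subst hj
    rw [Function.update_self]
    simp [Sales.groupSales, Sales.record, Finset.sum_add_distrib, hk]
  · rw [Function.update_of_ne hj]
    simp [Sales.groupSales, Sales.record, hj]

namespace Market

variable {K N : ℕ} (M : Market K N)

/-- Probability, given `D`, that the next consumer belongs to a class in `C` and buys `i`. -/
noncomputable def groupBuyProb (π : Display K N) (C : Finset (Fin K)) (D : Sales K N)
    (i : Fin N) : ℝ := ∑ k ∈ C, M.buyProb π D k i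

/-- Contribution of the classes in `C` to the weighted average quality of item `i`. -/
noncomputable def groupQuality (C : Finset (Fin K)) (i : Fin N) : ℝ :=
  ∑ k ∈ C, M.weight k * M.quality i k

lemma groupQuality_nonneg (C : Finset (Fin K)) (i : Fin N) : 0 ≤ M.groupQuality C i :=
  Finset.sum_nonneg fun k _ => mul_nonneg (M.weight_nonneg k) (M.quality_nonneg i k)

lemma nextMean_comp_groupSales (π : Display K N) (C : Finset (Fin K)) (F : (Fin N → ℕ) → ℝ)
    (D : Sales K N) :
    M.nextMean π (fun D => F (D.groupSales C)) D = F (D.groupSales C) +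
      ∑ i, M.groupBuyProb π C D i *
        (F (Function.update (D.groupSales C) i (D.groupSales C i + 1)) - F (D.groupSales C)) := by
  rw [nextMean_eq_add]
  congr 1
  rw [← Finset.sum_subset (Finset.subset_univ C), Finset.sum_comm]
  · refine Finset.sum_congr rfl fun i _ => ?_
    rw [groupBuyProb, Finset.sum_mul]
    exact Finset.sum_congr rfl fun k hk => by rw [D.groupSales_record_of_mem hk]
  · intro k _ hk
    exact Finset.sum_eq_zero fun i _ => by rw [D.groupSales_record_of_notMem hk, sub_self, mul_zero]

lemma exists_appeal_bounds : ∃ A B : ℝ, 0 < B ∧ B ≤ A ∧ (∀ i k, B ≤ M.appeal i k) ∧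
    ∀ i k, M.appeal i k ≤ A := by
  set S : ℝ := ∑ i, ∑ k, M.appeal i k
  set S' : ℝ := ∑ i, ∑ k, (M.appeal i k)⁻¹
  have hS0 : 0 ≤ S := Finset.sum_nonneg fun i _ => Finset.sum_nonneg fun k _ =>
    (M.appeal_pos i k).le
  have hS0' : 0 ≤ S' := Finset.sum_nonneg fun i _ => Finset.sum_nonneg fun k _ =>
    (inv_pos.2 (M.appeal_pos i k)).le
  have hS : ∀ i k, M.appeal i k ≤ S := fun i k =>
    (Finset.single_le_sum (f := fun k => M.appeal i k) (fun k _ => (M.appeal_pos i k).le)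
      (Finset.mem_univ k)).trans (Finset.single_le_sum (f := fun i => ∑ k, M.appeal i k)
        (fun i _ => Finset.sum_nonneg fun k _ => (M.appeal_pos i k).le) (Finset.mem_univ i))
  have hS' : ∀ i k, (M.appeal i k)⁻¹ ≤ S' := fun i k =>
    (Finset.single_le_sum (f := fun k => (M.appeal i k)⁻¹)
      (fun k _ => (inv_pos.2 (M.appeal_pos i k)).le)
      (Finset.mem_univ k)).trans (Finset.single_le_sum (f := fun i => ∑ k, (M.appeal i k)⁻¹)
        (fun i _ => Finset.sum_nonneg fun k _ => (inv_pos.2 (M.appeal_pos i k)).le)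
        (Finset.mem_univ i))
  -- Adding `1` to `S'` and `(S' + 1)⁻¹` to `S` keeps `0 < B ≤ A` even when there are no items or
  -- classes.
  refine ⟨S + (S' + 1)⁻¹, (S' + 1)⁻¹, by positivity, by linarith, fun i k => ?_, fun i k => ?_⟩
  · exact inv_le_of_inv_le₀ (M.appeal_pos i k) ((hS' i k).trans (by linarith))
  · have : 0 ≤ (S' + 1)⁻¹ := by positivity
    linarith [hS i k]

/-- A unique positive maximum of a finite family exceeds the other values, and `0`, by a gap. -/
lemma exists_gap {θ : Fin N → ℝ} {s : Fin N} (hs : 0 < θ s) (h : ∀ j, j ≠ s → θ j < θ s) :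
    ∃ δ, 0 < δ ∧ δ ≤ θ s ∧ ∀ j, j ≠ s → θ j + δ ≤ θ s := by
  have hne : (Finset.univ : Finset (Fin N)).Nonempty := ⟨s, Finset.mem_univ s⟩
  obtain ⟨m, -, hm⟩ := Finset.exists_min_image Finset.univ
    (fun j => if j = s then θ s else θ s - θ j) hne
  refine ⟨if m = s then θ s else θ s - θ m, ?_, ?_, fun j hj => ?_⟩
  · split_ifs with hms
    exacts [hs, sub_pos.2 (h m hms)]
  · simpa using hm s (Finset.mem_univ s)
  · have := hm j (Finset.mem_univ j)
    rw [if_neg hj] at this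
    linarith

/-- Suppose the classes in `C` share one ranking `ρ` and the signal given by their own purchases.
If item `s` is the unique maximiser of quality times visibility for the group, then the
probability of a purchase by the group converges to the quality of `s` for the group. -/
theorem tendsto_meanFrom_groupBuyProb (π : Display K N) (C : Finset (Fin K))
    (ρ : Equiv.Perm (Fin N)) (hρ : ∀ k ∈ C, π.ranking k = ρ)
    (hsig : ∀ D, ∀ k ∈ C, π.signal D k = D.groupSales C) (s : Fin N)
    (hpos : 0 < M.groupQuality C s * M.visibility (ρ s))
    (htie : ∀ j, j ≠ s → M.groupQuality C j * M.visibility (ρ j) <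
      M.groupQuality C s * M.visibility (ρ s)) :
    Tendsto (fun t => M.meanFrom π t (fun D => ∑ i, M.groupBuyProb π C D i) 0) atTop
      (𝓝 (M.groupQuality C s)) := by
  obtain ⟨δ, hδ, hδs, hδj⟩ := exists_gap hpos htie
  obtain ⟨A, B, hB, hBA, haB, haA⟩ := M.exists_appeal_bounds
  have hA : 0 < A := hB.trans_le hBA
  set v : Fin N → ℝ := fun j => M.visibility (ρ j) with hv
  have hv0 : ∀ j, 0 ≤ v j := fun j => M.visibility_nonneg _
  have hvs : 0 < v s := pos_of_mul_pos_right hpos (M.groupQuality_nonneg C s)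
  set V : ℝ := ∑ j, v j with hV
  have hvV : ∀ j, v j ≤ V := fun j =>
    Finset.single_le_sum (fun j _ => hv0 j) (Finset.mem_univ j)
  have hV0 : 0 < V := hvs.trans_le (hvV s)
  set z := M.outside with hz
  have hz0 : 0 ≤ z := M.outside_nonneg
  -- Replacing all appeals by `A` or by `B` gives denominators `U` and `L` with `U - L = (A - B) *
  -- V` and `L ≥ v s * (d s + B)`, so `U / L ≤ 1 + c / (d s + B)`. This is the error that
  -- `decayPotential` must absorb.
  set c : ℝ := (A - B) * V / v s with hc
  have hc0 : 0 ≤ c := div_nonneg (mul_nonneg (sub_nonneg.2 hBA) hV0.le) hvs.le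
  obtain ⟨ε, κ, hε0, hε1, hκ, hpot⟩ := exists_decayPotential_add_one_le hB hc0
  set F := lyapunov s A B ε κ with hF
  have hF0 : ∀ d, 0 ≤ F d := lyapunov_nonneg s ε κ hA.le hB
  have hbuy : ∀ D, ∀ k ∈ C, ∀ i, M.buyProb π D k i = M.weight k *
      (v i * (M.appeal i k + D.groupSales C i) /
        (∑ j, v j * (M.appeal j k + D.groupSales C j) + z) * M.quality i k) := by
    intro D k hk i
    rw [buyProb, trialProb, hρ k hk, hsig D k hk]
  have hdrift : ∀ D : Sales K N, M.nextMean π (fun D => F (D.groupSales C)) D ≤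
      (1 - ε * δ / (A * V + z + V * D.size)) * F (D.groupSales C) := by
    intro D
    set d := D.groupSales C with hd
    set U : ℝ := ∑ j, v j * (A + d j) + z with hU
    set L : ℝ := ∑ j, v j * (B + d j) + z with hL
    have hLs : v s * (d s + B) ≤ L := by
      have := Finset.single_le_sum (f := fun j => v j * (B + (d j : ℝ)))
        (fun j _ => mul_nonneg (hv0 j) (by positivity)) (Finset.mem_univ s)
      beta_reduce at this
      rw [add_comm]
      linarith
    have hx0 : (0 : ℝ) < d s + B := by positivity
    have hL0 : 0 < L := (mul_pos hvs hx0).trans_le hLs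
    have hUL : U = L + (A - B) * V := by
      have : ∑ j, v j * (A + (d j : ℝ)) = ∑ j, v j * (B + (d j : ℝ)) + (A - B) * V := by
        rw [hV, Finset.mul_sum, ← Finset.sum_add_distrib]
        exact Finset.sum_congr rfl fun j _ => by ring
      rw [hU, hL, this]
      ring
    have hLU : L ≤ U := by
      rw [hUL]
      exact le_add_of_nonneg_right (mul_nonneg (sub_nonneg.2 hBA) hV0.le)
    have hU0 : 0 < U := hL0.trans_le hLU
    set Y : ℝ := 1 + c / (d s + B) with hY
    have hY1 : 1 ≤ Y := le_add_of_nonneg_right (by positivity)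
    have hUY : U ≤ L * Y := by
      have h1 : c / (d s + B) * (v s * (d s + B)) = (A - B) * V := by rw [hc]; field_simp
      have h2 : c / (d s + B) * (v s * (d s + B)) ≤ c / (d s + B) * L :=
        mul_le_mul_of_nonneg_left hLs (by positivity)
      rw [hY, hUL]
      linarith
    have hUsize : U ≤ A * V + z + V * D.size := by
      have h1 : U = A * V + z + ∑ j, v j * (d j : ℝ) := by
        rw [hU, hV, Finset.mul_sum]
        have : ∑ j, v j * (A + (d j : ℝ)) = ∑ j, A * v j + ∑ j, v j * (d j : ℝ) := by
          rw [← Finset.sum_add_distrib]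
          exact Finset.sum_congr rfl fun j _ => by ring
        rw [this]
        ring
      have h2 : ∑ j, v j * (d j : ℝ) ≤ V * D.size := by
        calc ∑ j, v j * (d j : ℝ) ≤ ∑ j, V * (d j : ℝ) :=
              Finset.sum_le_sum fun j _ => mul_le_mul_of_nonneg_right (hvV j) (Nat.cast_nonneg _)
          _ = V * ((∑ j, d j : ℕ) : ℝ) := by rw [← Finset.mul_sum]; push_cast; rfl
          _ ≤ _ := mul_le_mul_of_nonneg_left (by exact_mod_cast D.groupSales_le_size C) hV0.le
      linarith
    have hT : ∀ k, L ≤ ∑ j, v j * (M.appeal j k + d j) + z ∧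
        ∑ j, v j * (M.appeal j k + d j) + z ≤ U := fun k =>
      ⟨add_le_add_left (Finset.sum_le_sum fun j _ =>
          mul_le_mul_of_nonneg_left (by linarith [haB j k]) (hv0 j)) _,
        add_le_add_left (Finset.sum_le_sum fun j _ =>
          mul_le_mul_of_nonneg_left (by linarith [haA j k]) (hv0 j)) _⟩
    have hstep := lyapunov_drift_le (s := s) (d := d) (r := M.groupBuyProb π C D)
      (θ := fun j => M.groupQuality C j * v j) (κ := κ) hA hB hε0 hε1 hδ hU0 hY1
      (fun i => Finset.sum_nonneg fun k _ => M.buyProb_nonneg π D k i) hδs hδj ?_ ?_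
      (hpot _ (le_add_of_nonneg_left (Nat.cast_nonneg _)))
    · rw [nextMean_comp_groupSales]
      have h1 : ε * δ / (A * V + z + V * D.size) ≤ ε * δ / U :=
        div_le_div_of_nonneg_left (by positivity) hU0 hUsize
      have h2 := mul_le_mul_of_nonneg_right h1 (hF0 d)
      linarith
    · intro j _
      rw [groupBuyProb, groupQuality, Finset.sum_mul, Finset.sum_mul, Finset.mul_sum]
      refine Finset.sum_le_sum fun k hk => ?_
      rw [hbuy D k hk]
      have h1 : v j * (M.appeal j k + d j) / (∑ j, v j * (M.appeal j k + d j) + z) ≤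
          v j * (d j + A) * (Y / U) := by
        rw [div_eq_mul_inv]
        refine mul_le_mul (mul_le_mul_of_nonneg_left (by linarith [haA j k]) (hv0 j)) ?_
          (inv_nonneg.2 (hL0.le.trans (hT k).1)) (mul_nonneg (hv0 j) (by positivity))
        rw [inv_le_iff_one_le_mul₀ (hL0.trans_le (hT k).1), div_mul_eq_mul_div, one_le_div hU0,
          mul_comm]
        exact hUY.trans (mul_le_mul_of_nonneg_right (hT k).1 (zero_le_one.trans hY1))
      calc _ ≤ M.weight k * (v j * (d j + A) * (Y / U) * M.quality j k) :=
            mul_le_mul_of_nonneg_left (mul_le_mul_of_nonneg_right h1 (M.quality_nonneg j k))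
              (M.weight_nonneg k)
        _ = _ := by ring
    · rw [groupBuyProb, groupQuality, Finset.sum_mul, Finset.sum_div, Finset.mul_sum]
      refine Finset.sum_le_sum fun k hk => ?_
      rw [hbuy D k hk]
      have h1 : v s * (d s + B) / U ≤
          v s * (M.appeal s k + d s) / (∑ j, v j * (M.appeal j k + d j) + z) :=
        div_le_div₀ (mul_nonneg hvs.le (by linarith [haB s k]))
          (mul_le_mul_of_nonneg_left (by linarith [haB s k]) hvs.le)
          (hL0.trans_le (hT k).1) (hT k).2
      calc _ = M.weight k * (v s * (d s + B) / U * M.quality s k) := by ring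
        _ ≤ _ := mul_le_mul_of_nonneg_left (mul_le_mul_of_nonneg_right h1 (M.quality_nonneg s k))
              (M.weight_nonneg k)
  have hlim : Tendsto (fun t => M.meanFrom π t (fun D => F (D.groupSales C)) 0) atTop (𝓝 0) := by
    refine tendsto_zero_of_harmonic_contraction (c := ε * δ) (a := A * V + z) (b := V)
      (by positivity) (by positivity) hV0.le
      (fun t => M.meanFrom_nonneg π t (fun D => hF0 _) 0) fun t => ?_
    rw [meanFrom_succ']
    have h := M.meanFrom_mono π (t := t) (D := 0) (f := M.nextMean π fun D => F (D.groupSales C))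
      (g := fun D => (1 - ε * δ / (A * V + z + V * t)) * F (D.groupSales C)) fun D hD => ?_
    · rwa [meanFrom_const_mul] at h
    · refine (hdrift D).trans (mul_le_mul_of_nonneg_right (sub_le_sub_left ?_ _) (hF0 _))
      rw [Sales.size_zero, zero_add] at hD
      have hD' : (D.size : ℝ) ≤ t := by exact_mod_cast hD
      exact div_le_div_of_nonneg_left (by positivity) (by positivity) (by gcongr)
  set W : ℝ := 1 + (∑ j, v j + z) / v s with hW
  -- Within a class, purchases of items other than `s` and the purchases of `s` lost to them or to
  -- the outside option both have probability in `[0, 1 - p s]`, so their difference is at most `1 -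
  -- p s`.
  have hclose : ∀ D : Sales K N, |∑ i, M.groupBuyProb π C D i - M.groupQuality C s| ≤
      (∑ k ∈ C, M.weight k) * W * F (D.groupSales C) := by
    intro D
    set d := D.groupSales C with hd
    simp only [groupBuyProb, groupQuality]
    rw [Finset.sum_comm, ← Finset.sum_sub_distrib]
    refine (Finset.abs_sum_le_sum_abs _ _).trans ?_
    rw [mul_assoc, Finset.sum_mul]
    refine Finset.sum_le_sum fun k hk => ?_
    set p : Fin N → ℝ := fun i => M.trialProb ρ d i k with hp
    have hp0 : ∀ i, 0 ≤ p i := fun i => M.trialProb_nonneg ρ d i k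
    have hp1 : ∑ i, p i ≤ 1 := M.sum_trialProb_le_one ρ d k
    have hps : 1 - p s ≤ W * F d :=
      one_sub_share_le_lyapunov d hv0 hvs hB (fun j => haB j k) (fun j => haA j k) hz0 hε0.le
        hε1 hκ
    have e : ∑ i, M.buyProb π D k i - M.weight k * M.quality s k = M.weight k *
        (∑ i ∈ Finset.univ.erase s, p i * M.quality i k - M.quality s k * (1 - p s)) := by
      have : ∀ i, M.buyProb π D k i = M.weight k * (p i * M.quality i k) := fun i => by
        rw [buyProb, hρ k hk, hsig D k hk]
      simp only [this]
      rw [← Finset.mul_sum, ← Finset.add_sum_erase _ _ (Finset.mem_univ s)]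
      ring
    rw [e, abs_mul, abs_of_nonneg (M.weight_nonneg k)]
    refine mul_le_mul_of_nonneg_left (le_trans ?_ hps) (M.weight_nonneg k)
    rw [← Finset.add_sum_erase _ _ (Finset.mem_univ s)] at hp1
    have h1 : ∑ i ∈ Finset.univ.erase s, p i * M.quality i k ≤ 1 - p s :=
      (Finset.sum_le_sum fun i _ => mul_le_of_le_one_right (hp0 i) (M.quality_le_one i k)).trans
        (by linarith)
    have h2 : 0 ≤ ∑ i ∈ Finset.univ.erase s, p i * M.quality i k :=
      Finset.sum_nonneg fun i _ => mul_nonneg (hp0 i) (M.quality_nonneg i k)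
    have h3 : 0 ≤ 1 - p s := by
      have := Finset.sum_nonneg fun i (_ : i ∈ Finset.univ.erase s) => hp0 i
      linarith
    have h4 := mul_le_of_le_one_left h3 (M.quality_le_one s k)
    have h5 := mul_nonneg (M.quality_nonneg s k) h3
    exact abs_le.2 ⟨by linarith, by linarith⟩
  rw [tendsto_iff_dist_tendsto_zero]
  have h := hlim.const_mul ((∑ k ∈ C, M.weight k) * W)
  rw [mul_zero] at h
  refine squeeze_zero (fun _ => dist_nonneg) (fun t => ?_) h
  rw [Real.dist_eq]
  refine (M.abs_meanFrom_sub_le π t hclose 0).trans_eq ?_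
  rw [meanFrom_const_mul]

end Market

/-! ### Limits under the two policies, and their comparison. -/

namespace Market

variable {K N : ℕ} (M : Market K N)

lemma totalBuyProb_eq_sum_groupBuyProb (π : Display K N) (D : Sales K N) :
    M.totalBuyProb π D = ∑ i, M.groupBuyProb π Finset.univ D i := Finset.sum_comm

lemma totalBuyProb_eq_sum_singleton (π : Display K N) (D : Sales K N) :
    M.totalBuyProb π D = ∑ k, ∑ i, M.groupBuyProb π {k} D i := by
  simp only [totalBuyProb, groupBuyProb, Finset.sum_singleton]

lemma trialProb_pos {σ : Equiv.Perm (Fin N)} {s : Fin N} (hs : 0 < M.visibility (σ s))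
    (d : Fin N → ℕ) (k : Fin K) : 0 < M.trialProb σ d s k := by
  have h : 0 < M.visibility (σ s) * (M.appeal s k + d s) :=
    mul_pos hs (add_pos_of_pos_of_nonneg (M.appeal_pos s k) (Nat.cast_nonneg _))
  exact div_pos h (add_pos_of_pos_of_nonneg (h.trans_le (Finset.single_le_sum
    (f := fun j => M.visibility (σ j) * (M.appeal j k + d j))
    (fun j _ => M.attraction_nonneg σ d j k) (Finset.mem_univ s))) M.outside_nonneg)

lemma totalBuyProb_global_pos {σ : Equiv.Perm (Fin N)} {s : Fin N}
    (hs : 0 < M.avgQuality s * M.visibility (σ s)) (D : Sales K N) :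
    0 < M.totalBuyProb (Display.global σ) D := by
  have hq : 0 < M.avgQuality s := pos_of_mul_pos_left hs (M.visibility_nonneg _)
  have hv : 0 < M.visibility (σ s) := pos_of_mul_pos_right hs hq.le
  obtain ⟨k, hk, hk'⟩ := Finset.exists_lt_of_sum_lt
    (s := Finset.univ) (f := fun _ : Fin K => (0 : ℝ)) (by simpa [avgQuality] using hq)
  have h : 0 < M.buyProb (Display.global σ) D k s := by
    rw [buyProb, mul_left_comm]
    exact mul_pos (M.trialProb_pos hv _ k) hk'
  exact Finset.sum_pos' (fun k _ => Finset.sum_nonneg fun i _ => M.buyProb_nonneg _ D k i)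
    ⟨k, hk, Finset.sum_pos' (fun i _ => M.buyProb_nonneg _ D k i) ⟨s, Finset.mem_univ s, h⟩⟩

theorem tendsto_purchaseProb_global {σ : Equiv.Perm (Fin N)} {s : Fin N}
    (hs : 0 < M.avgQuality s * M.visibility (σ s))
    (htie : ∀ j, j ≠ s →
      M.avgQuality j * M.visibility (σ j) < M.avgQuality s * M.visibility (σ s)) :
    Tendsto (M.purchaseProb (Display.global σ)) atTop (𝓝 (M.avgQuality s)) := by
  have h := M.tendsto_meanFrom_groupBuyProb (Display.global σ) Finset.univ σ (fun _ _ => rfl)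
    (fun _ _ _ => rfl) s hs htie
  refine h.congr fun t => ?_
  rw [purchaseProb_eq_meanFrom]
  congr 1
  funext D
  exact (M.totalBuyProb_eq_sum_groupBuyProb _ D).symm

lemma tendsto_meanFrom_segmented {τ : Fin K → Equiv.Perm (Fin N)} {k : Fin K} {s : Fin N}
    (hs : ∀ j, j ≠ s → M.quality j k < M.quality s k) (hv : 0 < M.visibility (τ k s))
    (hvs : ∀ j, M.visibility (τ k j) ≤ M.visibility (τ k s)) :
    Tendsto (fun t => M.meanFrom (Display.segmented τ) t
      (fun D => ∑ i, M.groupBuyProb (Display.segmented τ) {k} D i) 0) atTop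
      (𝓝 (M.weight k * M.quality s k)) := by
  have hq : ∀ j, M.quality j k ≤ M.quality s k := fun j => by
    rcases eq_or_ne j s with rfl | hj
    exacts [le_rfl, (hs j hj).le]
  -- A class of weight zero, or whose best quality is zero, has no positive maximiser, but it never
  -- buys and its limit is `0`.
  rcases (mul_nonneg (M.weight_nonneg k) (M.quality_nonneg s k)).eq_or_lt' with h0 | h0
  · have hb : ∀ D i, M.groupBuyProb (Display.segmented τ) {k} D i = 0 := by
      intro D i
      have hi : M.weight k * M.quality i k = 0 :=
        le_antisymm ((mul_le_mul_of_nonneg_left (hq i) (M.weight_nonneg k)).trans h0.le)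
          (mul_nonneg (M.weight_nonneg k) (M.quality_nonneg i k))
      rw [groupBuyProb, Finset.sum_singleton, buyProb, mul_left_comm, hi, mul_zero]
    simp only [hb, Finset.sum_const_zero, meanFrom_const, h0]
    exact tendsto_const_nhds
  · have hw : 0 < M.weight k := pos_of_mul_pos_left h0 (M.quality_nonneg s k)
    have e : ∀ i, M.groupQuality {k} i = M.weight k * M.quality i k := fun i =>
      Finset.sum_singleton _ _
    rw [← e]
    refine M.tendsto_meanFrom_groupBuyProb (Display.segmented τ) {k} (τ k) ?_ ?_ s ?_ ?_
    · intro l hl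
      rw [Finset.mem_singleton.1 hl]
      rfl
    · intro D l hl
      rw [Finset.mem_singleton.1 hl]
      funext i
      exact (Finset.sum_singleton (fun k => D k i) k).symm
    · rw [e]
      exact mul_pos h0 hv
    · intro j hj
      rw [e, e]
      exact (mul_le_mul_of_nonneg_left (hvs j)
        (mul_nonneg hw.le (M.quality_nonneg j k))).trans_lt
          (mul_lt_mul_of_pos_right (mul_lt_mul_of_pos_left (hs j hj) hw) hv)

theorem tendsto_purchaseProb_segmented {τ : Fin K → Equiv.Perm (Fin N)} {s : Fin K → Fin N}
    (hs : ∀ k j, j ≠ s k → M.quality j k < M.quality (s k) k)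
    (hv : ∀ k, 0 < M.visibility (τ k (s k)))
    (hvs : ∀ k j, M.visibility (τ k j) ≤ M.visibility (τ k (s k))) :
    Tendsto (M.purchaseProb (Display.segmented τ)) atTop
      (𝓝 (∑ k, M.weight k * M.quality (s k) k)) := by
  have h := tendsto_finsetSum Finset.univ fun k _ =>
    M.tendsto_meanFrom_segmented (hs k) (hv k) (hvs k)
  refine h.congr fun t => ?_
  rw [purchaseProb_eq_meanFrom, funext (M.totalBuyProb_eq_sum_singleton (Display.segmented τ)),
    meanFrom_sum]

end Market

theorem mainTheorem1 {K N : ℕ} (M : Market K N)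
    (σ : Equiv.Perm (Fin N)) (τ : Fin K → Equiv.Perm (Fin N))
    (hσ : M.IsAverageQualityRanking σ) (hτ : M.IsSegmentedQualityRanking τ)
    (hσ_tie : M.IsTieBreaking σ) (hτ_tie : M.IsSegmentedTieBreaking)
    (hpos : ∃ i, 0 < M.avgQuality i * M.visibility (σ i)) :
    (∀ t, 0 < M.purchaseProb (Display.global σ) t) ∧
    ∃ L : ℝ,
      Tendsto (fun t => M.purchaseProb (Display.segmented τ) t / M.purchaseProb (Display.global σ) t)
        atTop (𝓝 L) ∧
      1 ≤ L ∧ L ≤ K := by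
  obtain ⟨s, hs⟩ := hσ_tie
  have hs0 : 0 < M.avgQuality s * M.visibility (σ s) := by
    obtain ⟨i, hi⟩ := hpos
    rcases eq_or_ne i s with rfl | his
    exacts [hi, hi.trans (hs i his)]
  have hq : 0 < M.avgQuality s := pos_of_mul_pos_left hs0 (M.visibility_nonneg _)
  have hv : 0 < M.visibility (σ s) := pos_of_mul_pos_right hs0 hq.le
  choose b hb using hτ_tie
  have hb' : ∀ k j, M.quality j k ≤ M.quality (b k) k := fun k j => by
    rcases eq_or_ne j (b k) with rfl | hj
    exacts [le_rfl, (hb k j hj).le]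
  have hfirst : ∀ k j, τ k (b k) ≤ τ k j := by
    intro k j
    by_contra! h
    exact ((hb k j fun e => h.ne (congrArg _ e)).trans_le (hτ k _ _ h)).false
  -- The best item of a class stands first, so it is at least as visible as position `σ s`.
  have hbv : ∀ k, 0 < M.visibility (τ k (b k)) := by
    intro k
    have := hfirst k ((τ k).symm (σ s))
    rw [Equiv.apply_symm_apply] at this
    exact hv.trans_le (M.visibility_antitone this)
  -- An item ranked above `s` would have at least its average quality and its visibility,
  -- contradicting the strict maximality of the product at `s`.
  have hmax : ∀ j, M.avgQuality j ≤ M.avgQuality s := by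
    intro j
    rcases lt_trichotomy (σ j) (σ s) with h | h | h
    · exact absurd (hs j fun e => h.ne (congrArg _ e)) (not_lt.2 (mul_le_mul (hσ _ _ h)
        (M.visibility_antitone h.le) hv.le (hq.le.trans (hσ _ _ h))))
    · rw [σ.injective h]
    · exact hσ _ _ h
  have hglobal := M.tendsto_purchaseProb_global hs0 hs
  have hseg := M.tendsto_purchaseProb_segmented hb hbv
    fun k j => M.visibility_antitone (hfirst k j)
  refine ⟨fun t => ?_, _, hseg.div hglobal hq.ne', ?_, ?_⟩
  · rw [M.purchaseProb_eq_meanFrom]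
    exact M.meanFrom_pos _ t (M.totalBuyProb_global_pos hs0) 0
  · rw [one_le_div hq]
    exact Finset.sum_le_sum fun k _ =>
      mul_le_mul_of_nonneg_left (hb' k s) (M.weight_nonneg k)
  · rw [div_le_iff₀ hq]
    -- One class's contribution to the average quality of `b k` is at most that whole average.
    have h : ∀ k ∈ Finset.univ, M.weight k * M.quality (b k) k ≤ M.avgQuality s := fun k hk =>
      (Finset.single_le_sum (f := fun k' => M.weight k' * M.quality (b k) k')
        (fun k' _ => mul_nonneg (M.weight_nonneg k') (M.quality_nonneg _ k')) hk).trans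
          (hmax (b k))
    simpa using Finset.sum_le_card_nsmul _ _ _ h
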